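/- Let $p$ be a prime number and let $(R,\mathfrak m,K)$ be a Noetherian local ring of characteristic $p$ that is complete in the $\mathfrak m$-adic topology. Let $R^{o}$ be the complement in $R$ of the union of the minimal primes of $R$. For $e \ge 0$ let $R^{e}$ be the ring $R$ regarded as an $R$-algebra through $r \mapsto r^{p^{e}}$, and for an $R$-module $M$ put $F^{e}(M) = R^{e} \otimes_R M$. For a submodule $N \subseteq M$, the tight closure $N^{*}_M$ is the set of all $m \in M$ for which there is $c \in R^{o}$ such that $c \otimes m \in \operatorname{Im}(F^{e}(N) \to F^{e}(M))$ for all sufficiently large $e$; for an ideal $I$ of $R$ write $I^{*} = I^{*}_R$. The finitistic tight closure $N^{*fg}_M$ is the union of the submodules $(N \cap M')^{*}_{M'}$ over all finitely generated submodules $M'$ of $M$. Let $E_R(K)$ be the injective hull of the residue field $K$, and let $M^{\vee} = \operatorname{Hom}_R(M, E_R(K))$ be the Matlis dual of $M$. Define $$\tau_M = \{\varphi \in M^{\vee} : \varphi(x) = 0 \text{ for all } x \in 0^{*}_M\}, \qquad \tau^{fg}_M = \{\varphi \in M^{\vee} : \varphi(x) = 0 \text{ for all } x \in 0^{*fg}_M\}.$$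 **Theorem.** Let $M$ be an Artinian $R$-module. Then, for every ideal $I$ of $R$, $$I^{*}\,\tau_M = I\,\tau_M \qquad\text{and}\qquad I^{*}\,\tau^{fg}_M = I\,\tau^{fg}_M .$$ -/

import Mathlib

open scoped TensorProduct

universe u v w

namespace TightClosure

/-! ### Injective hulls -/

section InjectiveHull

variable {R : Type u} [CommRing R]

/-- `ι : K → E` is an injective hull of `K`: it is an essential monomorphism (every nonzero
submodule of `E` meets the image of `K` nontrivially) into an injective module. -/
structure IsInjectiveHull {K E : Type u} [AddCommGroup K] [Module R K] [AddCommGroup E]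
    [Module R E] (ι : K →ₗ[R] E) : Prop where
  injective_module : Module.Injective R E
  injective_map : Function.Injective ι
  essential : ∀ L : Submodule R E, L ≠ ⊥ → L ⊓ LinearMap.range ι ≠ ⊥

/-- Elementwise form of "`N` is an essential extension of `K`" inside an ambient module. -/
def EssentialOver {J : Type u} [AddCommGroup J] [Module R J] (K N : Submodule R J) : Prop :=
  ∀ x ∈ N, x ≠ 0 → ∃ r : R, r • x ≠ 0 ∧ r • x ∈ K

/-- An essential extension of `K` that is maximal inside an injective module is injective. -/
theorem injective_of_maximal_essential {J : Type u} [AddCommGroup J] [Module R J]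
    (hJ : Module.Injective R J) (K N : Submodule R J)
    (hN : Maximal (fun L : Submodule R J => K ≤ L ∧ EssentialOver K L) N) :
    Module.Injective R N := by
  obtain ⟨C, -, hC⟩ := zorn_le_nonempty₀ {C : Submodule R J | ∀ x ∈ C, x ∈ N → x = 0} (by
    intro c hc hchain y hy
    refine ⟨sSup c, ?_, fun z hz => le_sSup hz⟩
    intro x hx hxN
    obtain ⟨D, hD, hxD⟩ := (Submodule.mem_sSup_of_directed ⟨y, hy⟩ hchain.directedOn).1 hx
    exact hc hD x hxD hxN) ⊥ (by intro x hx _; simpa using hx)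
  have hC0 : ∀ x ∈ C, x ∈ N → x = 0 := hC.prop
  let f : N →ₗ[R] J ⧸ C := C.mkQ ∘ₗ N.subtype
  have hf : Function.Injective f := by
    rw [← LinearMap.ker_eq_bot, LinearMap.ker_eq_bot']
    intro x hx
    have hx' : (x : J) ∈ C := by simpa [f] using hx
    exact Subtype.ext (hC0 x hx' x.2)
  obtain ⟨g, hg⟩ := hJ.out f hf N.subtype
  -- every nonzero element of the quotient has a nonzero multiple in the image of `N`
  have hess : ∀ y : J ⧸ C, y ≠ 0 → ∃ r : R, ∃ n : N, r • y = f n ∧ n ≠ 0 := by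
    intro y hy
    obtain ⟨y, rfl⟩ := C.mkQ_surjective y
    by_contra! hcon
    have hyC : y ∉ C := by
      intro h
      exact hy (by simpa using h)
    have hmem : C ⊔ Submodule.span R {y} ∈
        {C : Submodule R J | ∀ x ∈ C, x ∈ N → x = 0} := by
      intro x hx hxN
      obtain ⟨a, ha, b, hb, rfl⟩ := Submodule.mem_sup.1 hx
      obtain ⟨r, rfl⟩ := Submodule.mem_span_singleton.1 hb
      have h1 : r • C.mkQ y = f ⟨a + r • y, hxN⟩ := by
        have : C.mkQ a = 0 := by simpa using ha
        simp only [f, LinearMap.comp_apply, Submodule.subtype_apply, map_add, map_smul, this,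
          zero_add]
      have h2 := hcon r _ h1
      simpa using congrArg Subtype.val h2
    have hle := hC.le_of_ge hmem le_sup_left
    exact hyC (hle (Submodule.mem_sup_right (Submodule.mem_span_singleton_self y)))
  have hrange : LinearMap.range g ≤ N := by
    apply hN.le_of_ge (y := LinearMap.range g)
    · refine ⟨?_, ?_⟩
      · intro x hx
        exact ⟨f ⟨x, hN.prop.1 hx⟩, hg _⟩
      · rintro _ ⟨y, rfl⟩ hy
        have hy0 : y ≠ 0 := by
          rintro rfl
          exact hy (map_zero g)
        obtain ⟨r, n, hrn, hn⟩ := hess y hy0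
        have h1 : r • g y = (n : J) := by
          rw [← map_smul, hrn, hg]; rfl
        obtain ⟨s, hs0, hsK⟩ := hN.prop.2 n n.2 (by simpa using hn)
        refine ⟨s * r, ?_, ?_⟩
        · rwa [mul_smul, h1]
        · rwa [mul_smul, h1]
    · intro x hx
      exact ⟨f ⟨x, hx⟩, hg _⟩
  let ρ : J →ₗ[R] N := (g ∘ₗ C.mkQ).codRestrict N fun x => hrange ⟨_, rfl⟩
  have hρ : ∀ n : N, ρ n = n := fun n => Subtype.ext (hg n)
  refine ⟨fun X Y _ _ _ _ i hi t => ?_⟩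
  obtain ⟨h, hh⟩ := hJ.out i hi (N.subtype ∘ₗ t)
  refine ⟨ρ ∘ₗ h, fun x => ?_⟩
  rw [LinearMap.comp_apply, hh]
  exact hρ _

/-- Every module has an injective hull. -/
theorem exists_isInjectiveHull (K : Type u) [AddCommGroup K] [Module R K] :
    ∃ (E : ModuleCat.{u} R) (ι : K →ₗ[R] E), IsInjectiveHull ι := by
  let P := (CategoryTheory.EnoughInjectives.presentation (ModuleCat.of R K)).some
  have hJ : Module.Injective R P.J :=
    (Module.injective_iff_injective_object R P.J).2 P.injective
  let φ : K →ₗ[R] P.J := P.f.hom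
  have hφ : Function.Injective φ := (ModuleCat.mono_iff_injective P.f).1 P.mono
  obtain ⟨N, hKN, hN⟩ := zorn_le_nonempty₀
    {L : Submodule R P.J | LinearMap.range φ ≤ L ∧ EssentialOver (LinearMap.range φ) L} (by
    intro c hc hchain y hy
    refine ⟨sSup c, ⟨(hc hy).1.trans (le_sSup hy), ?_⟩, fun z hz => le_sSup hz⟩
    intro x hx hx0
    obtain ⟨D, hD, hxD⟩ := (Submodule.mem_sSup_of_directed ⟨y, hy⟩ hchain.directedOn).1 hx
    exact (hc hD).2 x hxD hx0) (LinearMap.range φ)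
    ⟨le_rfl, fun x hx hx0 => ⟨1, by simpa using hx0, by simpa using hx⟩⟩
  refine ⟨ModuleCat.of R N, φ.codRestrict N fun x => hKN ⟨x, rfl⟩,
    injective_of_maximal_essential hJ _ N hN, ?_, ?_⟩
  · intro x y hxy
    exact hφ (congrArg Subtype.val hxy)
  · intro L hL
    obtain ⟨x, hxL, hx0⟩ := Submodule.exists_mem_ne_zero_of_ne_bot hL
    obtain ⟨r, hr0, k, hk⟩ := hN.prop.2 (x : N).1 (x : N).2
      (fun h => hx0 (Subtype.ext h))
    refine (Submodule.ne_bot_iff _).2 ⟨r • x, ⟨L.smul_mem r hxL, k, Subtype.ext hk⟩, ?_⟩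
    intro h
    exact hr0 (congrArg Subtype.val h)

end InjectiveHull

/-! ### The Matlis dual -/

section Matlis

variable (R : Type u) [CommRing R] [IsLocalRing R]

/-- The injective hull `E_R(K)` of the residue field `K` of the local ring `R`. -/
noncomputable def ResidueHull : Type u :=
  (exists_isInjectiveHull (R := R) (IsLocalRing.ResidueField R)).choose

noncomputable instance : AddCommGroup (ResidueHull R) :=
  inferInstanceAs (AddCommGroup
    (exists_isInjectiveHull (R := R) (IsLocalRing.ResidueField R)).choose)

noncomputable instance : Module R (ResidueHull R) :=
  inferInstanceAs (Module R
    (exists_isInjectiveHull (R := R) (IsLocalRing.ResidueField R)).choose)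

/-- The embedding of the residue field into its injective hull. -/
noncomputable def residueHullMap : IsLocalRing.ResidueField R →ₗ[R] ResidueHull R :=
  (exists_isInjectiveHull (R := R) (IsLocalRing.ResidueField R)).choose_spec.choose

theorem isInjectiveHull_residueHullMap : IsInjectiveHull (residueHullMap R) :=
  (exists_isInjectiveHull (R := R) (IsLocalRing.ResidueField R)).choose_spec.choose_spec

/-- The Matlis dual `Hom_R(M, E_R(K))`. -/
abbrev MatlisDual (M : Type v) [AddCommGroup M] [Module R M] : Type (max v u) :=
  M →ₗ[R] ResidueHull R

variable {R}

/-- The annihilator in the Matlis dual of `M` of a submodule `N` of `M`, under the evaluation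
pairing. -/
def matlisAnnihilator {M : Type v} [AddCommGroup M] [Module R M] (N : Submodule R M) :
    Submodule R (MatlisDual R M) where
  carrier := {φ | ∀ x ∈ N, φ x = 0}
  zero_mem' := fun _ _ => rfl
  add_mem' := by
    intro φ ψ hφ hψ x hx
    rw [LinearMap.add_apply, hφ x hx, hψ x hx, add_zero]
  smul_mem' := by
    intro r φ hφ x hx
    rw [LinearMap.smul_apply, hφ x hx, smul_zero]

end Matlis

/-! ### Frobenius functors and tight closure -/

section Frobenius

/-- `R^e`: the ring `R`, to be regarded as an `R`-algebra through the `e`-th iterate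
`r ↦ r ^ p ^ e` of the Frobenius. -/
def FrobeniusRing (R : Type u) (_p _e : ℕ) : Type u := R

variable (R : Type u) [CommRing R] (p : ℕ) [Fact p.Prime] [CharP R p] (e : ℕ)

instance : CommRing (FrobeniusRing R p e) := inferInstanceAs (CommRing R)

/-- The identity of the underlying rings. -/
def toFrobeniusRing : R ≃+* FrobeniusRing R p e := RingEquiv.refl R

noncomputable instance : Algebra R (FrobeniusRing R p e) :=
  ((toFrobeniusRing R p e).toRingHom.comp (iterateFrobenius R p e)).toAlgebra

theorem smul_toFrobeniusRing (r c : R) :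
    r • toFrobeniusRing R p e c = toFrobeniusRing R p e (r ^ p ^ e * c) := rfl

/-- `F^e(M) = R^e ⊗_R M`. -/
abbrev FrobeniusFunctor (M : Type v) [AddCommGroup M] [Module R M] : Type (max u v) :=
  FrobeniusRing R p e ⊗[R] M

/-- `R^o`, the complement of the union of the minimal primes of `R`. -/
def ringCirc : Set R := {c | ∀ P ∈ minimalPrimes R, c ∉ P}

variable {R}

theorem one_mem_ringCirc : (1 : R) ∈ ringCirc R := fun P hP h =>
  (Ideal.IsMinimalPrime.isPrime hP).ne_top ((Ideal.eq_top_iff_one P).2 h)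

theorem mul_mem_ringCirc {c d : R} (hc : c ∈ ringCirc R) (hd : d ∈ ringCirc R) :
    c * d ∈ ringCirc R := fun P hP h =>
  ((Ideal.IsMinimalPrime.isPrime hP).mem_or_mem h).elim (hc P hP) (hd P hP)

variable {M : Type v} [AddCommGroup M] [Module R M]

/-- The element `c ⊗ m` of `F^e(M)`. -/
noncomputable def frobeniusTmul (c : R) (m : M) : FrobeniusFunctor R p e M :=
  toFrobeniusRing R p e c ⊗ₜ[R] m

/-- `N^{[q]}_M`: the image of `F^e(N) → F^e(M)`, a submodule over `R^e`. -/
noncomputable def frobeniusPower (N : Submodule R M) :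
    Submodule (FrobeniusRing R p e) (FrobeniusFunctor R p e M) :=
  LinearMap.range (N.subtype.baseChange (FrobeniusRing R p e))

theorem frobeniusTmul_mul (a c : R) (m : M) :
    frobeniusTmul p e (a * c) m = toFrobeniusRing R p e a • frobeniusTmul p e c m := by
  simp only [frobeniusTmul, TensorProduct.smul_tmul', map_mul, smul_eq_mul]

theorem frobeniusTmul_smul (c r : R) (m : M) :
    frobeniusTmul p e c (r • m) = frobeniusTmul p e (r ^ p ^ e * c) m := by
  rw [frobeniusTmul, ← TensorProduct.smul_tmul, smul_toFrobeniusRing, frobeniusTmul]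

/-- The tight closure `N^*_M` of the submodule `N` in `M`. -/
def tightClosure (N : Submodule R M) : Submodule R M where
  carrier := {m | ∃ c ∈ ringCirc R, ∃ e₀ : ℕ, ∀ e ≥ e₀,
    frobeniusTmul p e c m ∈ frobeniusPower p e N}
  zero_mem' := by
    refine ⟨1, one_mem_ringCirc, 0, fun e _ => ?_⟩
    rw [frobeniusTmul, TensorProduct.tmul_zero]
    exact zero_mem _
  add_mem' := by
    rintro m n ⟨c, hc, e₁, h₁⟩ ⟨d, hd, e₂, h₂⟩
    refine ⟨c * d, mul_mem_ringCirc hc hd, max e₁ e₂, fun e he => ?_⟩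
    have hm := h₁ e ((le_max_left _ _).trans he)
    have hn := h₂ e ((le_max_right _ _).trans he)
    have h : frobeniusTmul p e (c * d) (m + n) =
        frobeniusTmul p e (d * c) m + frobeniusTmul p e (c * d) n := by
      rw [mul_comm d c]
      exact TensorProduct.tmul_add _ _ _
    rw [h, frobeniusTmul_mul, frobeniusTmul_mul]
    exact add_mem (Submodule.smul_mem _ _ hm) (Submodule.smul_mem _ _ hn)
  smul_mem' := by
    rintro r m ⟨c, hc, e₁, h₁⟩
    refine ⟨c, hc, e₁, fun e he => ?_⟩
    rw [frobeniusTmul_smul, frobeniusTmul_mul]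
    exact Submodule.smul_mem _ _ (h₁ e he)

/-- The tight closure `I^*` of an ideal `I` of `R`. -/
abbrev idealTightClosure (I : Ideal R) : Ideal R := tightClosure p (M := R) I

/-- Tight closure is functorial. -/
theorem map_mem_tightClosure {M' : Type w} [AddCommGroup M'] [Module R M'] (f : M →ₗ[R] M')
    {N : Submodule R M} {N' : Submodule R M'} (hf : ∀ x ∈ N, f x ∈ N') {m : M}
    (hm : m ∈ tightClosure p N) : f m ∈ tightClosure p N' := by
  obtain ⟨c, hc, e₀, h⟩ := hm
  refine ⟨c, hc, e₀, fun e he => ?_⟩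
  obtain ⟨t, ht⟩ := h e he
  refine ⟨(f.restrict hf).baseChange (FrobeniusRing R p e) t, ?_⟩
  have key : N'.subtype ∘ₗ f.restrict hf = f ∘ₗ N.subtype := rfl
  rw [← LinearMap.comp_apply, ← LinearMap.baseChange_comp, key, LinearMap.baseChange_comp,
    LinearMap.comp_apply, ht]
  rfl

/-- The finitistic tight closure `N^{*fg}_M`: the union of `(N ∩ M')^*_{M'}` over all finitely
generated submodules `M'` of `M`. -/
def finitisticTightClosure (N : Submodule R M) : Submodule R M where
  carrier := ⋃ (M' : Submodule R M) (_ : M'.FG),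
    M'.subtype '' (tightClosure p (N.comap M'.subtype) : Set M')
  zero_mem' := by
    simp only [Set.mem_iUnion]
    exact ⟨⊥, Submodule.fg_bot, 0, zero_mem _, rfl⟩
  add_mem' := by
    intro a b ha hb
    simp only [Set.mem_iUnion] at ha hb ⊢
    obtain ⟨A, hA, a, ha, rfl⟩ := ha
    obtain ⟨B, hB, b, hb, rfl⟩ := hb
    refine ⟨A ⊔ B, hA.sup hB,
      Submodule.inclusion le_sup_left a + Submodule.inclusion le_sup_right b,
      add_mem ?_ ?_, rfl⟩
    · exact map_mem_tightClosure p (Submodule.inclusion (le_sup_left : A ≤ A ⊔ B)) (fun x hx => hx) ha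
    · exact map_mem_tightClosure p (Submodule.inclusion (le_sup_right : B ≤ A ⊔ B)) (fun x hx => hx) hb
  smul_mem' := by
    intro r a ha
    simp only [Set.mem_iUnion] at ha ⊢
    obtain ⟨A, hA, a, ha, rfl⟩ := ha
    exact ⟨A, hA, r • a, Submodule.smul_mem _ r ha, rfl⟩

end Frobenius

/-! ### Test modules -/

section TestModule

variable {R : Type u} [CommRing R] [IsLocalRing R] (p : ℕ) [Fact p.Prime] [CharP R p]
  (M : Type v) [AddCommGroup M] [Module R M]

/-- The test module `τ_M`: the annihilator of `0^*_M` in the Matlis dual of `M`. -/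
noncomputable def testModule : Submodule R (MatlisDual R M) :=
  matlisAnnihilator (tightClosure p (⊥ : Submodule R M))

/-- The test module `τ^{fg}_M`: the annihilator of `0^{*fg}_M` in the Matlis dual of `M`. -/
noncomputable def finitisticTestModule : Submodule R (MatlisDual R M) :=
  matlisAnnihilator (finitisticTightClosure p (⊥ : Submodule R M))

end TestModule

end TightClosure

/-! Write `N` for `0^*_M` or `0^{*fg}_M`, so that the test module is `N^⊥`. Let `b ∈ I^*` and `φ ∈
N^⊥`; the point is that `b φ ∈ I N^⊥`.

Since `R` is complete and `M` is Artinian, a submodule of `M^∨` consists of all functionals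
vanishing on its common zeros (`mem_of_forall_apply_eq_zero`). Hence it suffices that `φ (b x) = 0`
whenever `I N^⊥` kills `x`. For such `x`, every functional in `N^⊥` kills `I x`, and `E_R(K)` is a
cogenerator, so `I x ⊆ N`. What remains is a fact about tight closure alone: `I x ⊆ N` implies `I^*
x ⊆ N`. It follows by carrying `b ∈ I^*` along `r ↦ r x` to `b x ∈ (I x)^*`, and from `J^* ⊆ 0^*`
for finitely generated `J ⊆ 0^*`. In the finitistic case the same argument runs inside one finitely
generated submodule containing `x`.

The duality input is that endomorphisms of `E_R(K)` act as scalars on `𝔪`-power torsion. A length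
count gives this modulo each `𝔪 ^ k`, and completeness glues the scalars. -/

namespace TightClosure

/-! ### Matlis duality: cogeneration and length -/

section Duality

open IsLocalRing

variable {R : Type u} [CommRing R] [IsLocalRing R]

/-- Baer's criterion frees the modules from the single universe in which `Module.Injective` tests
extensions. -/
theorem residueHull_extension {M : Type v} {N : Type w} [AddCommGroup M] [Module R M]
    [AddCommGroup N] [Module R N] (f : M →ₗ[R] N) (hf : Function.Injective f)
    (g : M →ₗ[R] ResidueHull R) : ∃ h : N →ₗ[R] ResidueHull R, h ∘ₗ f = g :=
  (Module.Baer.of_injective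
    (isInjectiveHull_residueHullMap R).injective_module).extension_property f hf g

/-- The socle of `E_R(K)` is `K`. -/
theorem mem_range_residueHullMap {x : ResidueHull R} (hx : ∀ r ∈ maximalIdeal R, r • x = 0) :
    x ∈ LinearMap.range (residueHullMap R) := by
  by_cases hx0 : x = 0
  · exact hx0 ▸ zero_mem _
  have hne : Submodule.span R {x} ≠ ⊥ := by simpa using hx0
  obtain ⟨y, ⟨hy, hyK⟩, hy0⟩ := Submodule.exists_mem_ne_zero_of_ne_bot
    ((isInjectiveHull_residueHullMap R).essential _ hne)
  obtain ⟨r, rfl⟩ := Submodule.mem_span_singleton.1 hy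
  have hr : IsUnit r := by
    by_contra hr
    exact hy0 (hx r ((mem_maximalIdeal r).2 hr))
  exact (Submodule.smul_mem_iff_of_isUnit _ hr).1 hyK

/-- `E_R(K)` is a cogenerator. -/
theorem exists_matlisDual_apply_ne_zero {M : Type v} [AddCommGroup M] [Module R M]
    (N : Submodule R M) {x : M} (hx : x ∉ N) :
    ∃ φ ∈ matlisAnnihilator N, φ x ≠ 0 := by
  -- The cyclic module generated by the class of `x` is nonzero, so it surjects onto `K`; the map to
  -- `E_R(K)` obtained this way extends to `M ⧸ N`.
  let g : R →ₗ[R] M ⧸ N := LinearMap.toSpanSingleton R _ (N.mkQ x)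
  have hker : LinearMap.ker g ≤ maximalIdeal R := by
    refine le_maximalIdeal fun h => hx ?_
    have h1 : (1 : R) ∈ LinearMap.ker g := h ▸ Submodule.mem_top
    simpa [g] using h1
  let π : R →ₗ[R] ResidueHull R := residueHullMap R ∘ₗ Algebra.linearMap R (ResidueField R)
  have hπ : LinearMap.ker g ≤ LinearMap.ker π := fun r hr => by
    have h0 : residue R r = 0 := (residue_eq_zero_iff r).2 (hker hr)
    change residueHullMap R (residue R r) = 0
    rw [h0, map_zero]
  obtain ⟨h, hh⟩ := residueHull_extension ((LinearMap.ker g).liftQ g le_rfl)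
    (LinearMap.ker_eq_bot.1 (Submodule.ker_liftQ_eq_bot _ _ _ le_rfl))
    ((LinearMap.ker g).liftQ π hπ)
  refine ⟨h ∘ₗ N.mkQ, fun y hy => ?_, ?_⟩
  · have : N.mkQ y = 0 := by simpa using hy
    rw [LinearMap.comp_apply, this, map_zero]
  · have h1 := LinearMap.congr_fun hh (Submodule.Quotient.mk 1)
    have h2 : h (N.mkQ x) = π 1 := by
      rw [← one_smul R (N.mkQ x)]
      exact h1
    rw [LinearMap.comp_apply, h2]
    intro h3
    have h4 : (algebraMap R (ResidueField R)) 1 = 0 :=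
      (isInjectiveHull_residueHullMap R).injective_map (h3.trans (map_zero _).symm)
    rw [map_one] at h4
    exact one_ne_zero h4

/-- The annihilator of the part of `E_R(K)` killed by an ideal is that ideal. -/
theorem mem_of_forall_smul_residueHull_eq_zero (J : Ideal R) {r : R}
    (h : ∀ x : ResidueHull R, (∀ a ∈ J, a • x = 0) → r • x = 0) : r ∈ J := by
  by_contra hr
  obtain ⟨φ, hφ, hφr⟩ := exists_matlisDual_apply_ne_zero J hr
  refine hφr ?_
  rw [← mul_one r, ← smul_eq_mul, map_smul]
  exact h _ fun a ha => by rw [← map_smul, smul_eq_mul, mul_one, hφ a ha]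

/-- A generator `s` of `S` is killed by `𝔪`, so evaluation at `s` embeds the dual into the socle of
`E_R(K)`, a copy of `K`. -/
theorem length_matlisDual_le_one {S : Type v} [AddCommGroup S] [Module R S]
    [IsSimpleModule R S] : Module.length R (MatlisDual R S) ≤ 1 := by
  obtain ⟨J, hJ, ⟨e⟩⟩ := isSimpleModule_iff_quot_maximal.1 ‹IsSimpleModule R S›
  have hK : IsSimpleModule R (ResidueField R) :=
    isSimpleModule_iff_quot_maximal.2 ⟨maximalIdeal R, inferInstance, ⟨LinearEquiv.refl R _⟩⟩
  rw [← Module.length_eq_one (R := R) (M := ResidueField R)]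
  let s : S := e.symm (Submodule.Quotient.mk 1)
  have hs : ∀ r ∈ maximalIdeal R, r • s = 0 := by
    intro r hr
    rw [← eq_maximalIdeal hJ] at hr
    rw [← map_smul, ← Submodule.Quotient.mk_smul, smul_eq_mul, mul_one,
      (Submodule.Quotient.mk_eq_zero J).2 hr, map_zero]
  let ev : MatlisDual R S →ₗ[R] LinearMap.range (residueHullMap R) :=
    (LinearMap.applyₗ s).codRestrict _ fun f => mem_range_residueHullMap fun r hr => by
      rw [LinearMap.applyₗ_apply_apply, ← map_smul, hs r hr, map_zero]
  have hev : Function.Injective ev := by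
    intro f g hfg
    have h0 : f s = g s := congrArg Subtype.val hfg
    refine LinearMap.ext fun x => ?_
    obtain ⟨y, rfl⟩ := e.symm.surjective x
    obtain ⟨r, rfl⟩ := Submodule.Quotient.mk_surjective J y
    have : e.symm (Submodule.Quotient.mk r) = r • s := by
      rw [← map_smul, ← Submodule.Quotient.mk_smul, smul_eq_mul, mul_one]
    rw [this, map_smul, map_smul, h0]
  exact (Module.length_le_of_injective ev hev).trans
    (Module.length_le_of_surjective (residueHullMap R).rangeRestrict
      (LinearMap.surjective_rangeRestrict _))

/-- Matlis duality does not increase length. -/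
theorem length_matlisDual_le {N : Type v} [AddCommGroup N] [Module R N]
    (hN : IsFiniteLength R N) : Module.length R (MatlisDual R N) ≤ Module.length R N := by
  induction hN with
  | of_subsingleton => simp [Module.length_eq_zero]
  | @of_simple_quotient N _ _ N' _ _ ih =>
    let res : MatlisDual R N →ₗ[R] MatlisDual R N' := LinearMap.lcomp R _ N'.subtype
    let infl : MatlisDual R (N ⧸ N') →ₗ[R] MatlisDual R N := LinearMap.lcomp R _ N'.mkQ
    have hinj : Function.Injective infl := fun f g hfg =>
      Submodule.linearMap_qext _ hfg
    -- Left exactness is enough for the inequality, so `res` is replaced by its corestriction to its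
    -- range.
    have hex : Function.Exact infl res.rangeRestrict := by
      intro f
      constructor
      · intro hf
        have hf' : N' ≤ LinearMap.ker f := fun x hx =>
          LinearMap.congr_fun (congrArg Subtype.val hf) ⟨x, hx⟩
        exact ⟨N'.liftQ f hf', N'.liftQ_mkQ f hf'⟩
      · rintro ⟨g, rfl⟩
        refine Subtype.ext (LinearMap.ext fun x => ?_)
        have : N'.mkQ (x : N) = 0 := by simp
        change g (N'.mkQ x) = 0
        rw [this, map_zero]
    rw [Module.length_eq_add_of_exact infl res.rangeRestrict hinj
      (LinearMap.surjective_rangeRestrict _) hex,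
      Module.length_eq_add_of_exact N'.subtype N'.mkQ N'.subtype_injective
      N'.mkQ_surjective (LinearMap.exact_subtype_mkQ N'), add_comm]
    refine add_le_add ?_ ?_
    · exact (Module.length_le_of_injective _ (Submodule.subtype_injective _)).trans ih
    · rw [Module.length_eq_one (R := R) (M := N ⧸ N')]
      exact length_matlisDual_le_one

/-! ### Endomorphisms of `E_R(K)` and double annihilators -/

variable [IsNoetherianRing R]

theorem isFiniteLength_quotient_maximalIdeal_pow (k : ℕ) :
    IsFiniteLength R (R ⧸ maximalIdeal R ^ k) := by
  have hA : IsArtinianRing (R ⧸ maximalIdeal R ^ k) := by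
    cases subsingleton_or_nontrivial (R ⧸ maximalIdeal R ^ k)
    · infer_instance
    have := IsLocalRing.of_surjective' (Ideal.Quotient.mk (maximalIdeal R ^ k))
      Ideal.Quotient.mk_surjective
    have := IsLocalHom.of_surjective (Ideal.Quotient.mk (maximalIdeal R ^ k))
      Ideal.Quotient.mk_surjective
    refine (isArtinianRing_iff_isNilpotent_maximalIdeal _).2 ⟨k, ?_⟩
    have hmap : maximalIdeal (R ⧸ maximalIdeal R ^ k) =
        (maximalIdeal R).map (Ideal.Quotient.mk (maximalIdeal R ^ k)) := by
      refine le_antisymm (fun x hx => ?_) (((local_hom_TFAE _).out 0 2).1 ‹_›)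
      obtain ⟨x, rfl⟩ := Ideal.Quotient.mk_surjective x
      exact Ideal.mem_map_of_mem _ (fun hu => hx (hu.map _))
    rw [hmap, ← Ideal.map_pow, Ideal.map_quotient_self, Ideal.zero_eq_bot]
  have : IsArtinian R (R ⧸ maximalIdeal R ^ k) :=
    isArtinian_of_surjective_algebraMap (R := R ⧸ maximalIdeal R ^ k) (S := R)
      Ideal.Quotient.mk_surjective
  exact isFiniteLength_iff_isNoetherian_isArtinian.2 ⟨inferInstance, this⟩

/-- On the part of `E_R(K)` killed by `𝔪 ^ k`, an endomorphism of `E_R(K)` is a homothety. -/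
theorem exists_smul_eq_of_pow_smul_eq_zero (f : ResidueHull R →ₗ[R] ResidueHull R) (k : ℕ) :
    ∃ r : R, ∀ x : ResidueHull R, (∀ a ∈ maximalIdeal R ^ k, a • x = 0) → f x = r • x := by
  -- The range of `ev` is the part of `E_R(K)` killed by `𝔪 ^ k`, identified with the dual of `R ⧸ 𝔪
  -- ^ k`.
  let ev : MatlisDual R (R ⧸ maximalIdeal R ^ k) →ₗ[R] ResidueHull R :=
    LinearMap.applyₗ (Submodule.Quotient.mk 1)
  have hmem : ∀ x : ResidueHull R, (∀ a ∈ maximalIdeal R ^ k, a • x = 0) →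
      x ∈ LinearMap.range ev := fun x hx =>
    ⟨Submodule.liftQ _ (LinearMap.toSpanSingleton R _ x) hx, one_smul R x⟩
  have hfin := isFiniteLength_quotient_maximalIdeal_pow (R := R) k
  have hlen : Module.length R (LinearMap.range ev) ≤ Module.length R (R ⧸ maximalIdeal R ^ k) :=
    (Module.length_le_of_surjective ev.rangeRestrict
      (LinearMap.surjective_rangeRestrict _)).trans (length_matlisDual_le hfin)
  have hfinE : IsFiniteLength R (LinearMap.range ev) :=
    Module.length_ne_top_iff.1 (ne_top_of_le_ne_top (Module.length_ne_top_iff.2 hfin) hlen)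
  have hlen' : Module.length R (MatlisDual R (LinearMap.range ev)) ≤
      Module.length R (R ⧸ maximalIdeal R ^ k) := (length_matlisDual_le hfinE).trans hlen
  obtain ⟨_, _⟩ := isFiniteLength_iff_isNoetherian_isArtinian.1 (Module.length_ne_top_iff.1
    (ne_top_of_le_ne_top (Module.length_ne_top_iff.2 hfin) hlen'))
  let g : R →ₗ[R] MatlisDual R (LinearMap.range ev) :=
    LinearMap.toSpanSingleton R _ (LinearMap.range ev).subtype
  have hg : LinearMap.ker g ≤ maximalIdeal R ^ k := by
    intro r hr
    refine mem_of_forall_smul_residueHull_eq_zero _ fun x hx => ?_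
    exact LinearMap.congr_fun (LinearMap.mem_ker.1 hr) ⟨x, hmem x hx⟩
  -- The range of `g` is `R ⧸ ker g`, which surjects onto `R ⧸ 𝔪 ^ k`; its length is therefore at
  -- least the bound `hlen'` for the whole finite-length target, so it cannot be proper.
  have htop : LinearMap.range g = ⊤ := by
    by_contra hne
    refine (Submodule.length_lt hne).not_ge (hlen'.trans ?_)
    rw [← g.quotKerEquivRange.length_eq]
    exact Module.length_le_of_surjective (Submodule.factor hg) (Submodule.factor_surjective hg)
  obtain ⟨r, hr⟩ : f ∘ₗ (LinearMap.range ev).subtype ∈ LinearMap.range g :=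
    htop ▸ Submodule.mem_top
  exact ⟨r, fun x hx => (LinearMap.congr_fun hr ⟨x, hmem x hx⟩).symm⟩

/-- Over a complete ring, an endomorphism of `E_R(K)` is a homothety on the `𝔪`-power torsion. -/
theorem exists_smul_eq_of_isAdicComplete [IsAdicComplete (maximalIdeal R) R]
    (f : ResidueHull R →ₗ[R] ResidueHull R) :
    ∃ r : R, ∀ (k : ℕ) (x : ResidueHull R),
      (∀ a ∈ maximalIdeal R ^ k, a • x = 0) → f x = r • x := by
  choose s hs using exists_smul_eq_of_pow_smul_eq_zero f
  obtain ⟨r, hr⟩ := IsPrecomplete.prec' (I := maximalIdeal R) (M := R) s (by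
    intro m n hmn
    rw [SModEq.sub_mem, smul_eq_mul, Ideal.mul_top]
    -- Both `s m` and `s n` act as `f` on the `𝔪 ^ m`-torsion, whose annihilator is `𝔪 ^ m`.
    refine mem_of_forall_smul_residueHull_eq_zero _ fun x hx => ?_
    rw [sub_smul, ← hs m x hx, ← hs n x fun a ha => hx a (Ideal.pow_le_pow_right hmn ha),
      sub_self])
  refine ⟨r, fun k x hx => ?_⟩
  have h := hr k
  rw [SModEq.sub_mem, smul_eq_mul, Ideal.mul_top] at h
  rw [hs k x hx, ← sub_eq_zero, ← sub_smul]
  exact hx _ h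

theorem exists_pow_smul_eq_zero_of_isArtinian {M : Type v} [AddCommGroup M] [Module R M]
    [IsArtinian R M] (x : M) : ∃ k : ℕ, ∀ a ∈ maximalIdeal R ^ k, a • x = 0 := by
  obtain ⟨k, hk⟩ := IsArtinian.monotone_stabilizes (R := R) (M := M)
    ⟨fun k => OrderDual.toDual (maximalIdeal R ^ k • Submodule.span R {x}),
      fun m n h => Submodule.smul_mono_left (Ideal.pow_le_pow_right h)⟩
  have hk' : maximalIdeal R ^ k • Submodule.span R {x} =
      maximalIdeal R ^ (k + 1) • Submodule.span R {x} := hk (k + 1) k.le_succ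
  -- Nakayama, applied to the finitely generated module `𝔪 ^ k x = 𝔪 ^ (k + 1) x`.
  have h0 : maximalIdeal R ^ k • Submodule.span R {x} = ⊥ := by
    refine Submodule.eq_bot_of_le_smul_of_le_jacobson_bot (maximalIdeal R) _
      (Submodule.FG.smul (IsNoetherian.noetherian (maximalIdeal R ^ k)) (Submodule.fg_span_singleton x)) ?_
      (jacobson_eq_maximalIdeal ⊥ bot_ne_top).ge
    rw [← Submodule.mul_smul, ← pow_succ', ← hk']
  refine ⟨k, fun a ha => ?_⟩
  rw [← Submodule.mem_bot (R := R), ← h0]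
  exact Submodule.smul_mem_smul ha (Submodule.mem_span_singleton_self x)

/-- Over a complete ring, every submodule of the Matlis dual of an Artinian module is the
annihilator of its annihilator. -/
theorem mem_of_forall_apply_eq_zero [IsAdicComplete (maximalIdeal R) R] {M : Type v}
    [AddCommGroup M] [Module R M] [IsArtinian R M] (L : Submodule R (MatlisDual R M))
    {φ : MatlisDual R M} (hφ : ∀ x, (∀ ψ ∈ L, ψ x = 0) → φ x = 0) : φ ∈ L := by
  classical
  -- By the descending chain condition, finitely many elements of `L` already have the same common
  -- kernel as all of `L`.
  obtain ⟨_, ⟨s, rfl⟩, hs⟩ := IsArtinian.set_has_minimal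
    (Set.range fun s : Finset L => ⨅ ψ ∈ s, LinearMap.ker ψ.1) ⟨_, ∅, rfl⟩
  let Φ : M →ₗ[R] s → ResidueHull R := LinearMap.pi fun ψ => ψ.1.1
  have hker : LinearMap.ker Φ ≤ LinearMap.ker φ := by
    intro x hx
    refine hφ x fun ψ hψ => ?_
    have hle : ⨅ χ ∈ insert (⟨ψ, hψ⟩ : L) s, LinearMap.ker χ.1 ≤
        ⨅ χ ∈ s, LinearMap.ker χ.1 :=
      biInf_mono fun _ => Finset.mem_insert_of_mem
    have heq := eq_of_le_of_not_lt hle (hs _ ⟨_, rfl⟩)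
    have hxs : x ∈ ⨅ χ ∈ s, LinearMap.ker χ.1 := by
      simp only [Submodule.mem_iInf]
      exact fun χ hχ => congrFun hx ⟨χ, hχ⟩
    rw [← heq] at hxs
    simp only [Submodule.mem_iInf] at hxs
    exact hxs ⟨ψ, hψ⟩ (Finset.mem_insert_self _ _)
  obtain ⟨g, hg⟩ := residueHull_extension ((LinearMap.ker Φ).liftQ Φ le_rfl)
    (LinearMap.ker_eq_bot.1 (Submodule.ker_liftQ_eq_bot _ _ _ le_rfl))
    ((LinearMap.ker Φ).liftQ φ hker)
  -- Each component of `g` is an endomorphism of `E_R(K)`. It acts as a scalar on the values `ψ x`,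
  -- which are `𝔪`-power torsion because `M` is Artinian.
  choose r hr using fun ψ : s => exists_smul_eq_of_isAdicComplete
    (g ∘ₗ LinearMap.single R (fun _ : s => ResidueHull R) ψ)
  have hsum : φ = ∑ ψ : s, r ψ • ψ.1.1 := by
    refine LinearMap.ext fun x => ?_
    obtain ⟨k, hk⟩ := exists_pow_smul_eq_zero_of_isArtinian (R := R) x
    have h1 : g (Φ x) = φ x := LinearMap.congr_fun hg (Submodule.Quotient.mk x)
    rw [← h1, ← LinearMap.sum_single_apply (fun _ : s => ResidueHull R) (Φ x), map_sum,
      LinearMap.sum_apply]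
    refine Finset.sum_congr rfl fun ψ _ => hr ψ k _ fun a ha => ?_
    change a • ψ.1.1 x = 0
    rw [← map_smul, hk a ha, map_zero]
  rw [hsum]
  exact Submodule.sum_mem _ fun ψ _ => L.smul_mem _ ψ.1.2

end Duality

/-! ### Tight closure of finitely generated submodules -/

section TightClosure

variable {R : Type u} [CommRing R] (p : ℕ) [Fact p.Prime] [CharP R p]
  {M : Type v} [AddCommGroup M] [Module R M]

theorem frobeniusTmul_mem_frobeniusPower (e : ℕ) {N : Submodule R M} (c : R) {y : M}
    (hy : y ∈ N) : frobeniusTmul p e c y ∈ frobeniusPower p e N :=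
  ⟨toFrobeniusRing R p e c ⊗ₜ[R] (⟨y, hy⟩ : N), rfl⟩

theorem le_tightClosure (N : Submodule R M) : N ≤ tightClosure p N := fun _ hy =>
  ⟨1, one_mem_ringCirc, 0, fun e _ => frobeniusTmul_mem_frobeniusPower p e 1 hy⟩

/-- A single multiplier works for a finitely generated submodule of the tight closure. -/
theorem exists_uniform_multiplier {N J : Submodule R M} (hJ : J.FG)
    (hJN : J ≤ tightClosure p N) :
    ∃ c ∈ ringCirc R, ∃ e₀ : ℕ, ∀ e ≥ e₀, ∀ y ∈ J,
      frobeniusTmul p e c y ∈ frobeniusPower p e N := by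
  induction J, hJ using Submodule.fg_induction with
  | singleton x =>
    obtain ⟨c, hc, e₀, h⟩ := hJN (Submodule.mem_span_singleton_self x)
    refine ⟨c, hc, e₀, fun e he y hy => ?_⟩
    obtain ⟨r, rfl⟩ := Submodule.mem_span_singleton.1 hy
    rw [frobeniusTmul_smul, frobeniusTmul_mul]
    exact Submodule.smul_mem _ _ (h e he)
  | sup A B _ _ hA hB =>
    obtain ⟨c, hc, e₁, h₁⟩ := hA (le_sup_left.trans hJN)
    obtain ⟨d, hd, e₂, h₂⟩ := hB (le_sup_right.trans hJN)
    refine ⟨c * d, mul_mem_ringCirc hc hd, max e₁ e₂, fun e he y hy => ?_⟩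
    obtain ⟨a, ha, b, hb, rfl⟩ := Submodule.mem_sup.1 hy
    have h : frobeniusTmul p e (c * d) (a + b) =
        frobeniusTmul p e (d * c) a + frobeniusTmul p e (c * d) b := by
      rw [mul_comm d c]
      exact TensorProduct.tmul_add _ _ _
    rw [h, frobeniusTmul_mul, frobeniusTmul_mul]
    exact add_mem (Submodule.smul_mem _ _ (h₁ e ((le_max_left _ _).trans he) a ha))
      (Submodule.smul_mem _ _ (h₂ e ((le_max_right _ _).trans he) b hb))

/-- Finite generation gives one multiplier `c` and one bound on `e` for all of `J`; the product of
`c` with a multiplier for `m` then works. -/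
theorem tightClosure_le_of_fg {N J : Submodule R M} (hJ : J.FG)
    (hJN : J ≤ tightClosure p N) : tightClosure p J ≤ tightClosure p N := by
  obtain ⟨c, hc, e₁, h₁⟩ := exists_uniform_multiplier p hJ hJN
  rintro m ⟨d, hd, e₂, h₂⟩
  refine ⟨c * d, mul_mem_ringCirc hc hd, max e₁ e₂, fun e he => ?_⟩
  rw [frobeniusTmul_mul]
  obtain ⟨t, ht⟩ := h₂ e ((le_max_right _ _).trans he)
  rw [← ht]
  clear ht
  induction t using TensorProduct.induction_on with
  | zero => rw [map_zero, smul_zero]; exact zero_mem _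
  | add a b ha hb => rw [map_add, smul_add]; exact add_mem ha hb
  | tmul a y =>
    obtain ⟨a, rfl⟩ := (toFrobeniusRing R p e).surjective a
    change toFrobeniusRing R p e c • frobeniusTmul p e a (y : M) ∈ _
    -- Commuting `c` past `a` leaves `c ⊗ y`, to which the uniform multiplier applies.
    rw [← frobeniusTmul_mul, mul_comm, frobeniusTmul_mul]
    exact Submodule.smul_mem _ _ (h₁ e ((le_max_left _ _).trans he) y y.2)

/-- The map `r ↦ r x` sends `I^*` into the tight closure of the finitely generated submodule `I x`.
-/
theorem smul_mem_tightClosure {N : Submodule R M} {I : Ideal R} (hI : I.FG) {x : M}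
    (hx : ∀ a ∈ I, a • x ∈ tightClosure p N) {b : R} (hb : b ∈ idealTightClosure p I) :
    b • x ∈ tightClosure p N := by
  refine tightClosure_le_of_fg p (Submodule.FG.map (LinearMap.toSpanSingleton R M x) hI) ?_
    (map_mem_tightClosure p (LinearMap.toSpanSingleton R M x)
      (fun a ha => Submodule.mem_map_of_mem ha) hb)
  rintro _ ⟨a, ha, rfl⟩
  exact hx a ha

theorem mem_finitisticTightClosure {N : Submodule R M} {x : M} :
    x ∈ finitisticTightClosure p N ↔ ∃ A : Submodule R M, A.FG ∧
      x ∈ (tightClosure p (N.comap A.subtype)).map A.subtype := by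
  change x ∈ ⋃ (M' : Submodule R M) (_ : M'.FG), _ ↔ _
  simp only [Set.mem_iUnion, exists_prop]
  rfl

theorem map_tightClosure_comap_mono (N : Submodule R M) {A B : Submodule R M} (h : A ≤ B) :
    (tightClosure p (N.comap A.subtype)).map A.subtype ≤
      (tightClosure p (N.comap B.subtype)).map B.subtype := by
  rintro _ ⟨a, ha, rfl⟩
  exact ⟨Submodule.inclusion h a,
    map_mem_tightClosure p (Submodule.inclusion h) (fun x hx => hx) ha, rfl⟩

/-- Each generator has its own witnessing submodule; the sum of finitely many witnesses serves all
of `J`. -/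
theorem exists_fg_of_le_finitisticTightClosure {N J : Submodule R M} (hJ : J.FG)
    (hJN : J ≤ finitisticTightClosure p N) :
    ∃ A : Submodule R M, A.FG ∧ J ≤ (tightClosure p (N.comap A.subtype)).map A.subtype := by
  induction J, hJ using Submodule.fg_induction with
  | singleton x =>
    obtain ⟨A, hA, hx⟩ := (mem_finitisticTightClosure p).1
      (hJN (Submodule.mem_span_singleton_self x))
    exact ⟨A, hA, (Submodule.span_singleton_le_iff_mem _ _).2 hx⟩
  | sup J₁ J₂ _ _ h₁ h₂ =>
    obtain ⟨A, hA, hA'⟩ := h₁ (le_sup_left.trans hJN)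
    obtain ⟨B, hB, hB'⟩ := h₂ (le_sup_right.trans hJN)
    exact ⟨A ⊔ B, hA.sup hB, sup_le (hA'.trans (map_tightClosure_comap_mono p N le_sup_left))
      (hB'.trans (map_tightClosure_comap_mono p N le_sup_right))⟩

theorem smul_mem_finitisticTightClosure {N : Submodule R M} {I : Ideal R} (hI : I.FG) {x : M}
    (hx : ∀ a ∈ I, a • x ∈ finitisticTightClosure p N) {b : R}
    (hb : b ∈ idealTightClosure p I) : b • x ∈ finitisticTightClosure p N := by
  obtain ⟨A, hA, hA'⟩ := exists_fg_of_le_finitisticTightClosure p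
    (Submodule.FG.map (LinearMap.toSpanSingleton R M x) hI) (by
      rintro _ ⟨a, ha, rfl⟩
      exact hx a ha)
  -- `A` accounts for `I x` but need not contain `x`, which must lie in the ambient module for `r ↦
  -- r x` to land there.
  let B := A ⊔ Submodule.span R {x}
  let y : B := ⟨x, le_sup_right (a := A) (Submodule.mem_span_singleton_self x)⟩
  refine (mem_finitisticTightClosure p).2 ⟨B, hA.sup (Submodule.fg_span_singleton x), b • y,
    smul_mem_tightClosure p hI (fun a ha => ?_) hb, rfl⟩
  obtain ⟨z, hz, hzx⟩ := map_tightClosure_comap_mono p N (le_sup_left : A ≤ B)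
    (hA' (Submodule.mem_map_of_mem ha))
  rwa [show a • y = z from Subtype.ext hzx.symm]

end TightClosure

/-! ### Transfer to annihilators and conclusion -/

/-- If multiplication into `N` from `I` implies multiplication into `N` from `J`, then
`J • N^⊥ ≤ I • N^⊥`. -/
theorem smul_matlisAnnihilator_le {R : Type u} [CommRing R] [IsLocalRing R] [IsNoetherianRing R]
    [IsAdicComplete (IsLocalRing.maximalIdeal R) R] {M : Type v} [AddCommGroup M] [Module R M]
    [IsArtinian R M] {I J : Ideal R} {N : Submodule R M}
    (h : ∀ x : M, (∀ a ∈ I, a • x ∈ N) → ∀ b ∈ J, b • x ∈ N) :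
    J • matlisAnnihilator N ≤ I • matlisAnnihilator N := by
  refine Submodule.smul_le.2 fun b hb φ hφ => mem_of_forall_apply_eq_zero _ fun x hx => ?_
  rw [LinearMap.smul_apply, ← map_smul]
  refine hφ _ (h x (fun a ha => ?_) b hb)
  -- If `a x ∉ N`, some `ψ ∈ N^⊥` has `ψ (a x) ≠ 0`, although `a ψ ∈ I N^⊥` kills `x`.
  by_contra hax
  obtain ⟨ψ, hψ, hψx⟩ := exists_matlisDual_apply_ne_zero N hax
  refine hψx ?_
  rw [map_smul]
  exact hx _ (Submodule.smul_mem_smul ha hψ)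

end TightClosure

theorem mainTheorem1 {R : Type u} [CommRing R] [IsLocalRing R] [IsNoetherianRing R]
    [IsAdicComplete (IsLocalRing.maximalIdeal R) R] (p : ℕ) [Fact p.Prime] [CharP R p]
    (M : Type v) [AddCommGroup M] [Module R M] [IsArtinian R M] (I : Ideal R) :
    TightClosure.idealTightClosure p I • TightClosure.testModule (R := R) p M =
        I • TightClosure.testModule (R := R) p M ∧
      TightClosure.idealTightClosure p I • TightClosure.finitisticTestModule (R := R) p M =
        I • TightClosure.finitisticTestModule (R := R) p M := by
  have hI : I.FG := IsNoetherian.noetherian I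
  have hle := TightClosure.le_tightClosure p (M := R) I
  exact ⟨le_antisymm
      (TightClosure.smul_matlisAnnihilator_le fun _ hx _ hb =>
        TightClosure.smul_mem_tightClosure p hI hx hb)
      (Submodule.smul_mono_left hle),
    le_antisymm
      (TightClosure.smul_matlisAnnihilator_le fun _ hx _ hb =>
        TightClosure.smul_mem_finitisticTightClosure p hI hx hb)
      (Submodule.smul_mono_left hle)⟩
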